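/- Let $X$ be a complex Banach space and let $A\in L(X)$ be a bounded linear operator, with dual operator $A'\in L(X')$, $A'f=f\circ A$. For a subspace $M\subseteq X$ put $M^\perp=\{f\in X' : f|_M=0\}$. Write $(M,N)\in \mathrm{Red}(A)$ if $M$ and $N$ are closed $A$-invariant subspaces with $X=M\oplus N$; then $A_M$ and $A_N$ denote the restrictions of $A$ to operators on $M$ and on $N$. A bounded operator on a Banach space is called left (right) invertible if it has a bounded left (right) inverse. An operator $T\in L(Y)$ is called Riesz if for every $\lambda\in\mathbb C\setminus\{0\}$ the null-space of $T-\lambda I$ has finite dimension and the range of $T-\lambda I$ has finite codimension. $T$ is called left generalized Drazin-Riesz invertible if there is $B\in L(Y)$ such that $TBT=BT^2$, $B^2T=B$ and $T-TBT$ is Riesz, and right generalized Drazin-Riesz invertible if there is $B\in L(Y)$ such that $TBT=T^2B$, $TB^2=B$ and $T-TBT$ is Riesz. Then: (i) If $(M,N)\in \mathrm{Red}(A)$, $A_M$ is left invertible and $A_N$ is Riesz, then $(N^\perp,M^\perp)\in \mathrm{Red}(A')$, $A'_{N^\perp}$ is right invertible and $A'_{M^\perp}$ is Riesz. (ii) If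 $(M,N)\in \mathrm{Red}(A)$, $A_M$ is right invertible and $A_N$ is Riesz, then $(N^\perp,M^\perp)\in \mathrm{Red}(A')$, $A'_{N^\perp}$ is left invertible and $A'_{M^\perp}$ is Riesz. (iii) If $A$ is left generalized Drazin-Riesz invertible, then $A'$ is right generalized Drazin-Riesz invertible. (iv) If $A$ is right generalized Drazin-Riesz invertible, then $A'$ is left generalized Drazin-Riesz invertible. -/

import Mathlib

noncomputable section

variable {X : Type*} [NormedAddCommGroup X] [NormedSpace ℂ X]

/-- `(M, N) ∈ Red(A)`: `M` and `N` are closed `A`-invariant subspaces with `X = M ⊕ N`. -/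
structure CompletelyReduces (A : X →L[ℂ] X) (M N : Submodule ℂ X) : Prop where
  isClosed_left : IsClosed (M : Set X)
  isClosed_right : IsClosed (N : Set X)
  isCompl : IsCompl M N
  invariant_left : ∀ x ∈ M, A x ∈ M
  invariant_right : ∀ x ∈ N, A x ∈ N

/-- A Riesz operator: for every nonzero `z`, the null-space of `A - zI` has finite dimension
and the range of `A - zI` has finite codimension. -/
def IsRieszOperator (A : X →L[ℂ] X) : Prop :=
  ∀ z : ℂ, z ≠ 0 →
    FiniteDimensional ℂ (LinearMap.ker (A - z • ContinuousLinearMap.id ℂ X : X →L[ℂ] X).toLinearMap) ∧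
    FiniteDimensional ℂ
      (X ⧸ LinearMap.range (A - z • ContinuousLinearMap.id ℂ X : X →L[ℂ] X).toLinearMap)

/-- The dual operator `A′ : X′ → X′`, `A′ f = f ∘ A`. -/
def dualOperator (A : X →L[ℂ] X) : StrongDual ℂ X →L[ℂ] StrongDual ℂ X :=
  ContinuousLinearMap.precomp ℂ A

/-- The annihilator `M^⊥ ⊆ X′` of a subspace `M` of `X`:
the continuous functionals that vanish on `M`. -/
def annihilatorDual (M : Submodule ℂ X) : Submodule ℂ (StrongDual ℂ X) :=
  StrongDual.polarSubmodule ℂ M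

theorem dualOperator_apply (A : X →L[ℂ] X) (f : StrongDual ℂ X) (x : X) :
    dualOperator A f x = f (A x) := rfl

theorem mem_annihilatorDual (M : Submodule ℂ X) (f : StrongDual ℂ X) :
    f ∈ annihilatorDual M ↔ ∀ x ∈ M, f x = 0 :=
  StrongDual.mem_polarSubmodule ℂ M f

/-- `A` is left generalized Drazin-Riesz invertible. -/
def IsLeftGenDrazinRieszInvertible (A : X →L[ℂ] X) : Prop :=
  ∃ B : X →L[ℂ] X, A * B * A = B * A ^ 2 ∧ B ^ 2 * A = B ∧ IsRieszOperator (A - A * B * A)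

/-- `A` is right generalized Drazin-Riesz invertible. -/
def IsRightGenDrazinRieszInvertible (A : X →L[ℂ] X) : Prop :=
  ∃ B : X →L[ℂ] X, A * B * A = A ^ 2 * B ∧ A * B ^ 2 = B ∧ IsRieszOperator (A - A * B * A)

end

/-! Duality reverses products, so a left inverse becomes a right inverse, and the dual of `B`
witnesses the opposite Drazin-Riesz property. The analytic input is that the Riesz property passes
to duals: if `F S F = F`, every functional `f` killing `ker F` equals `(f ∘ S) ∘ F`, so the range of
the dual of `F` has finite codimension. The bounded projections of `X = M ⊕ N` identify `M^⊥` with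
`N'` and `N^⊥` with `M'`, which reduces the restricted operators to duals of `A_N` and `A_M`. -/

/-! ### Fredholm and Riesz operators under duality -/

section FredholmDual

variable {Y : Type*} [NormedAddCommGroup Y] [NormedSpace ℂ Y]

/-- A bounded operator on a Banach space with finite-dimensional null-space and range of finite
codimension has a bounded generalized inverse. -/
theorem exists_generalizedInverse [CompleteSpace Y] (F : Y →L[ℂ] Y)
    [FiniteDimensional ℂ (LinearMap.ker F.toLinearMap)]
    [FiniteDimensional ℂ (Y ⧸ LinearMap.range F.toLinearMap)] :
    ∃ S : Y →L[ℂ] Y, ∀ x, F (S (F x)) = F x := by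
  obtain ⟨W, hWc, hW⟩ := (Submodule.ClosedComplemented.of_finiteDimensional
    (LinearMap.ker F.toLinearMap)).exists_isClosed_isCompl
  obtain ⟨G, hG⟩ := (LinearMap.range F.toLinearMap).exists_isCompl
  have hGfin : FiniteDimensional ℂ G :=
    (Submodule.quotientEquivOfIsCompl _ G hG).finiteDimensional
  have : CompleteSpace W := hWc.completeSpace_coe
  have : CompleteSpace G := FiniteDimensional.complete ℂ G
  have hdecomp : ∀ x : Y, ∃ w : W, F w = F x := by
    intro x
    obtain ⟨k, hk, w, hw, rfl⟩ := Submodule.mem_sup.1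
      (hW.sup_eq_top ▸ Submodule.mem_top : x ∈ LinearMap.ker F.toLinearMap ⊔ W)
    have hk0 : F k = 0 := hk
    exact ⟨⟨w, hw⟩, by simp [hk0]⟩
  let FW : W →L[ℂ] Y := F.comp W.subtypeL
  have hker : LinearMap.ker FW.toLinearMap = ⊥ := by
    refine (Submodule.eq_bot_iff _).2 fun w hw => ?_
    exact Subtype.ext ((Submodule.disjoint_def.1 hW.disjoint) w hw w.2)
  have hrange : LinearMap.range FW.toLinearMap = LinearMap.range F.toLinearMap := by
    refine le_antisymm ?_ ?_
    · rintro _ ⟨w, rfl⟩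
      exact ⟨w, rfl⟩
    · rintro _ ⟨x, rfl⟩
      obtain ⟨w, hw⟩ := hdecomp x
      exact ⟨w, hw⟩
  -- The map `(w, g) ↦ F w + g` is a continuous bijection of Banach spaces, so its inverse is
  -- bounded; closedness of the range is not needed beforehand.
  let e := FW.coprodSubtypeLEquivOfIsCompl (G := G) (by rwa [hrange]) hker
  have he : ∀ w : W, e (w, 0) = F w := by
    intro w
    simp [e, ContinuousLinearMap.coprodSubtypeLEquivOfIsCompl, FW]
  refine ⟨W.subtypeL ∘L ContinuousLinearMap.fst ℂ W G ∘L (e.symm : Y →L[ℂ] W × G), fun x => ?_⟩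
  obtain ⟨w, hw⟩ := hdecomp x
  have hsymm : e.symm (F w) = (w, 0) := by rw [← he, e.symm_apply_apply]
  simp [← hw, hsymm]

/-- A functional in this kernel vanishes on the range of `F`, so it factors through the
finite-dimensional cokernel. -/
theorem finiteDimensional_ker_dualOperator (F : Y →L[ℂ] Y)
    [FiniteDimensional ℂ (Y ⧸ LinearMap.range F.toLinearMap)] :
    FiniteDimensional ℂ (LinearMap.ker (dualOperator F).toLinearMap) := by
  have hle (f : LinearMap.ker (dualOperator F).toLinearMap) :
      LinearMap.range F.toLinearMap ≤ LinearMap.ker (f : StrongDual ℂ Y).toLinearMap := by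
    rintro _ ⟨x, rfl⟩
    have hf : dualOperator F (f : StrongDual ℂ Y) = 0 := f.2
    exact DFunLike.congr_fun hf x
  let φ : LinearMap.ker (dualOperator F).toLinearMap →ₗ[ℂ]
      Module.Dual ℂ (Y ⧸ LinearMap.range F.toLinearMap) :=
    { toFun := fun f => (LinearMap.range F.toLinearMap).liftQ _ (hle f)
      map_add' := fun f g => by ext; simp
      map_smul' := fun c f => by ext; simp }
  refine FiniteDimensional.of_injective φ fun f g hfg => ?_
  ext x
  exact DFunLike.congr_fun hfg (Submodule.Quotient.mk x)

theorem finiteDimensional_quotient_range_dualOperator [CompleteSpace Y] (F : Y →L[ℂ] Y)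
    [FiniteDimensional ℂ (LinearMap.ker F.toLinearMap)]
    [FiniteDimensional ℂ (Y ⧸ LinearMap.range F.toLinearMap)] :
    FiniteDimensional ℂ (StrongDual ℂ Y ⧸ LinearMap.range (dualOperator F).toLinearMap) := by
  obtain ⟨S, hS⟩ := exists_generalizedInverse F
  let ρ : StrongDual ℂ Y →ₗ[ℂ] Module.Dual ℂ (LinearMap.ker F.toLinearMap) :=
    { toFun := fun f => f.toLinearMap.comp (LinearMap.ker F.toLinearMap).subtype
      map_add' := fun _ _ => rfl
      map_smul' := fun _ _ => rfl }
  -- `ker ρ` has finite codimension because `ρ` restricts functionals to the finite-dimensional `ker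
  -- F`.
  have hρ : LinearMap.ker ρ ≤ LinearMap.range (dualOperator F).toLinearMap := by
    intro f hf
    refine ⟨f.comp S, ContinuousLinearMap.ext fun x => ?_⟩
    have hx : S (F x) - x ∈ LinearMap.ker F.toLinearMap := by simp [hS]
    have h0 : f (S (F x) - x) = 0 :=
      DFunLike.congr_fun (LinearMap.mem_ker.1 hf) (⟨_, hx⟩ : LinearMap.ker F.toLinearMap)
    rw [map_sub, sub_eq_zero] at h0
    exact h0
  have : FiniteDimensional ℂ (StrongDual ℂ Y ⧸ LinearMap.ker ρ) :=
    ρ.quotKerEquivRange.symm.finiteDimensional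
  exact Module.Finite.of_surjective _ (Submodule.factor_surjective hρ)

theorem dualOperator_sub_smul_id (T : Y →L[ℂ] Y) (z : ℂ) :
    dualOperator T - z • ContinuousLinearMap.id ℂ (StrongDual ℂ Y) =
      dualOperator (T - z • ContinuousLinearMap.id ℂ Y) := by
  ext f x
  simp [dualOperator_apply]

/-- The dual of a Riesz operator on a Banach space is a Riesz operator. -/
theorem IsRieszOperator.dualOperator [CompleteSpace Y] {T : Y →L[ℂ] Y} (hT : IsRieszOperator T) :
    IsRieszOperator (dualOperator T) := by
  intro z hz
  obtain ⟨_, _⟩ := hT z hz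
  rw [dualOperator_sub_smul_id]
  exact ⟨finiteDimensional_ker_dualOperator _, finiteDimensional_quotient_range_dualOperator _⟩

/-- The Riesz property is invariant under similarity. -/
theorem IsRieszOperator.of_linearEquiv {Z : Type*} [NormedAddCommGroup Z] [NormedSpace ℂ Z]
    {T : Y →L[ℂ] Y} (hT : IsRieszOperator T) (S : Z →L[ℂ] Z) (e : Z ≃ₗ[ℂ] Y)
    (he : ∀ x, e (S x) = T (e x)) : IsRieszOperator S := by
  intro z hz
  obtain ⟨_, _⟩ := hT z hz
  -- Only dimensions are compared, so `e` may be purely algebraic.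
  have hconj (x : Z) : e ((S - z • ContinuousLinearMap.id ℂ Z) x) =
      (T - z • ContinuousLinearMap.id ℂ Y) (e x) := by
    simp [he]
  constructor
  · refine FiniteDimensional.of_injective
      (e.toLinearMap.restrict (q := LinearMap.ker
        (T - z • ContinuousLinearMap.id ℂ Y : Y →L[ℂ] Y).toLinearMap) fun x hx => ?_)
      fun x y hxy => Subtype.ext (e.injective (congrArg Subtype.val hxy))
    have hx0 : (S - z • ContinuousLinearMap.id ℂ Z) x = 0 := hx
    exact (hconj x).symm.trans (by rw [hx0, map_zero])
  · refine (Submodule.Quotient.equiv _ _ e.symm ?_).finiteDimensional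
      (V := Y ⧸ LinearMap.range (T - z • ContinuousLinearMap.id ℂ Y : Y →L[ℂ] Y).toLinearMap)
    ext x
    constructor
    · rintro ⟨_, ⟨y, rfl⟩, rfl⟩
      refine ⟨e.symm y, e.injective ((hconj _).trans ?_)⟩
      simp
    · rintro ⟨y, rfl⟩
      exact ⟨_, ⟨e y, rfl⟩, e.injective (by simpa using (hconj y).symm)⟩

end FredholmDual

/-! ### Annihilators and reducing pairs -/

section Annihilator

variable {Y : Type*} [NormedAddCommGroup Y] [NormedSpace ℂ Y] {A : Y →L[ℂ] Y}
  {M N : Submodule ℂ Y}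

theorem isClosed_annihilatorDual (M : Submodule ℂ Y) :
    IsClosed (annihilatorDual M : Set (StrongDual ℂ Y)) := by
  have : (annihilatorDual M : Set (StrongDual ℂ Y)) =
      ⋂ x ∈ M, {f : StrongDual ℂ Y | f x = 0} := by
    ext f
    simp [mem_annihilatorDual]
  rw [this]
  exact isClosed_biInter fun x _ =>
    isClosed_eq (ContinuousLinearMap.apply ℂ ℂ x).continuous continuous_const

theorem apply_eq_of_isCompl {Z : Type*} [AddCommGroup Z] [Module ℂ Z] (h : IsCompl M N)
    {f g : Y →ₗ[ℂ] Z} (hM : ∀ x ∈ M, f x = g x) (hN : ∀ x ∈ N, f x = g x) (x : Y) :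
    f x = g x := by
  obtain ⟨m, hm, n, hn, rfl⟩ := Submodule.mem_sup.1
    (h.sup_eq_top ▸ Submodule.mem_top : x ∈ M ⊔ N)
  rw [map_add, map_add, hM m hm, hN n hn]

theorem CompletelyReduces.symm (h : CompletelyReduces A M N) : CompletelyReduces A N M :=
  ⟨h.isClosed_right, h.isClosed_left, h.isCompl.symm, h.invariant_right, h.invariant_left⟩

theorem annihilatorDual_invariant (hM : ∀ x ∈ M, A x ∈ M) :
    ∀ f ∈ annihilatorDual M, dualOperator A f ∈ annihilatorDual M := by
  simp only [mem_annihilatorDual]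
  exact fun f hf x hx => hf _ (hM x hx)

/-- A bounded projection onto the left summand along the right summand. -/
theorem CompletelyReduces.exists_projection [CompleteSpace Y] (h : CompletelyReduces A M N) :
    ∃ P : Y →L[ℂ] M, (∀ x : M, P x = x) ∧ ∀ x ∈ N, P x = 0 := by
  have ht := Submodule.IsCompl.isTopCompl_of_isClosed h.isCompl h.isClosed_left h.isClosed_right
  exact ⟨M.projectionOntoL N ht, Submodule.projectionOntoL_apply_left ht,
    fun x hx => (Submodule.projectionOntoL_apply_eq_zero_iff ht).2 hx⟩

theorem CompletelyReduces.dual [CompleteSpace Y] (h : CompletelyReduces A M N) :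
    CompletelyReduces (dualOperator A) (annihilatorDual N) (annihilatorDual M) := by
  refine ⟨isClosed_annihilatorDual N, isClosed_annihilatorDual M, ⟨?_, ?_⟩,
    annihilatorDual_invariant h.invariant_right, annihilatorDual_invariant h.invariant_left⟩
  · refine Submodule.disjoint_def.2 fun f hN hM => ?_
    rw [mem_annihilatorDual] at hN hM
    exact ContinuousLinearMap.ext fun x =>
      apply_eq_of_isCompl (g := 0) (f := f.toLinearMap) h.isCompl hM hN x
  · rw [codisjoint_iff, Submodule.eq_top_iff']
    intro f
    obtain ⟨P, hPM, hPN⟩ := h.exists_projection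
    -- With `P` viewed in `Y`, `f ∘ P` vanishes on `N` and `f - f ∘ P` vanishes on `M`.
    refine Submodule.mem_sup.2 ⟨f ∘L M.subtypeL ∘L P, ?_, f - f ∘L M.subtypeL ∘L P, ?_, by simp⟩
    · rw [mem_annihilatorDual]
      intro x hx
      simp [hPN x hx]
    · rw [mem_annihilatorDual]
      intro x hx
      simp [hPM ⟨x, hx⟩]

/-- Restriction of functionals to `N` identifies the annihilator of a closed complement of `N`
with the dual of `N`. -/
theorem CompletelyReduces.exists_annihilatorDual_equiv [CompleteSpace Y]
    (h : CompletelyReduces A M N) :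
    ∃ e : annihilatorDual M ≃ₗ[ℂ] StrongDual ℂ N,
      ∀ f, e f = (f : StrongDual ℂ Y).comp N.subtypeL := by
  obtain ⟨P, hPN, hPM⟩ := h.symm.exists_projection
  let r : annihilatorDual M →ₗ[ℂ] StrongDual ℂ N :=
    { toFun := fun f => (f : StrongDual ℂ Y).comp N.subtypeL
      map_add' := fun _ _ => rfl
      map_smul' := fun _ _ => rfl }
  refine ⟨LinearEquiv.ofBijective r ⟨fun f g hfg => ?_, fun g => ?_⟩, fun _ => rfl⟩
  · have hf := (mem_annihilatorDual M _).1 f.2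
    have hg := (mem_annihilatorDual M _).1 g.2
    refine Subtype.ext (ContinuousLinearMap.ext fun x => ?_)
    exact apply_eq_of_isCompl (f := (f : StrongDual ℂ Y).toLinearMap)
      (g := (g : StrongDual ℂ Y).toLinearMap) h.isCompl
      (fun x hx => (hf x hx).trans (hg x hx).symm)
      (fun x hx => DFunLike.congr_fun hfg (⟨x, hx⟩ : N)) x
  · refine ⟨⟨g.comp P, (mem_annihilatorDual M _).2 fun x hx => ?_⟩,
      ContinuousLinearMap.ext fun x => ?_⟩
    · simp [hPM x hx]
    · exact congrArg g (hPN x)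

theorem CompletelyReduces.isRieszOperator_dual [CompleteSpace Y] (h : CompletelyReduces A M N)
    (hA : IsRieszOperator (A.restrict h.invariant_right)) :
    IsRieszOperator (X := annihilatorDual M)
      ((dualOperator A).restrict h.dual.invariant_right) := by
  have : CompleteSpace N := h.isClosed_right.completeSpace_coe
  obtain ⟨e, he⟩ := h.exists_annihilatorDual_equiv
  refine IsRieszOperator.of_linearEquiv (Z := annihilatorDual M) hA.dualOperator _ e fun f => ?_
  rw [he, he]
  rfl

/-- The operator on the annihilator of `N` corresponding to the dual of `L : M → M`. -/
theorem CompletelyReduces.exists_dual_on_annihilator [CompleteSpace Y]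
    (h : CompletelyReduces A M N) (L : M →L[ℂ] M) :
    ∃ R : annihilatorDual N →L[ℂ] annihilatorDual N,
      ∀ (f : annihilatorDual N) (x : M),
        (R f : StrongDual ℂ Y) x = (f : StrongDual ℂ Y) (L x) := by
  obtain ⟨P, hPM, hPN⟩ := h.exists_projection
  -- Extending `L` by zero on `N` makes its dual send every functional into `N^⊥`.
  refine ⟨(dualOperator (M.subtypeL ∘L L ∘L P)).restrict fun f _ =>
    (mem_annihilatorDual N _).2 fun x hx => ?_, fun f x => ?_⟩
  · simp [dualOperator_apply, hPN x hx]
  · change (f : StrongDual ℂ Y) (L (P x)) = _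
    rw [hPM]

theorem annihilatorDual_ext (h : IsCompl M N) {f g : annihilatorDual N}
    (hfg : ∀ x : M, (f : StrongDual ℂ Y) x = (g : StrongDual ℂ Y) x) : f = g := by
  have hf := (mem_annihilatorDual N _).1 f.2
  have hg := (mem_annihilatorDual N _).1 g.2
  exact Subtype.ext (ContinuousLinearMap.ext fun x =>
    apply_eq_of_isCompl (f := (f : StrongDual ℂ Y).toLinearMap)
      (g := (g : StrongDual ℂ Y).toLinearMap) h (fun x hx => hfg ⟨x, hx⟩)
      (fun x hx => (hf x hx).trans (hg x hx).symm) x)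

/-- On `M`, `(R f) ∘ A = f ∘ L ∘ A = f`, and elements of `N^⊥` are determined by their values on
`M`. -/
theorem CompletelyReduces.hasRightInverse_dual [CompleteSpace Y] (h : CompletelyReduces A M N)
    (hA : (A.restrict h.invariant_left).HasLeftInverse) :
    ((dualOperator A).restrict h.dual.invariant_left).HasRightInverse := by
  obtain ⟨L, hL⟩ := hA
  obtain ⟨R, hR⟩ := h.exists_dual_on_annihilator L
  refine ⟨R, fun f => annihilatorDual_ext h.isCompl fun x => ?_⟩
  exact (hR f (A.restrict h.invariant_left x)).trans (by rw [hL x])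

theorem CompletelyReduces.hasLeftInverse_dual [CompleteSpace Y] (h : CompletelyReduces A M N)
    (hA : (A.restrict h.invariant_left).HasRightInverse) :
    ((dualOperator A).restrict h.dual.invariant_left).HasLeftInverse := by
  obtain ⟨L, hL⟩ := hA
  obtain ⟨R, hR⟩ := h.exists_dual_on_annihilator L
  refine ⟨R, fun f => annihilatorDual_ext h.isCompl fun x => (hR _ x).trans ?_⟩
  change (f : StrongDual ℂ Y) (A.restrict h.invariant_left (L x) : M) = _
  rw [hL x]

end Annihilator

/-! ### Duality for generalized Drazin-Riesz inverses -/

section DrazinRiesz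

variable {Y : Type*} [NormedAddCommGroup Y] [NormedSpace ℂ Y]

theorem dualOperator_sub (S T : Y →L[ℂ] Y) :
    dualOperator (S - T) = dualOperator S - dualOperator T := by
  ext f x
  simp [dualOperator_apply]

theorem IsLeftGenDrazinRieszInvertible.dualOperator [CompleteSpace Y] {A : Y →L[ℂ] Y}
    (h : IsLeftGenDrazinRieszInvertible A) :
    IsRightGenDrazinRieszInvertible (dualOperator A) := by
  obtain ⟨B, h₁, h₂, h₃⟩ := h
  refine ⟨_root_.dualOperator B, ?_, ?_, ?_⟩
  · rw [pow_two] at h₁ ⊢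
    -- Evaluated at `f` and `x`, the reversed identity is by definition `f` applied to the original
    -- one.
    exact ContinuousLinearMap.ext fun f => ContinuousLinearMap.ext fun x =>
      congrArg f (DFunLike.congr_fun h₁ x)
  · rw [pow_two] at h₂ ⊢
    exact ContinuousLinearMap.ext fun f => ContinuousLinearMap.ext fun x =>
      congrArg f (DFunLike.congr_fun h₂ x)
  -- The word `A * B * A` is a palindrome, so reversal preserves its form.
  · have h := h₃.dualOperator
    rwa [dualOperator_sub] at h

theorem IsRightGenDrazinRieszInvertible.dualOperator [CompleteSpace Y] {A : Y →L[ℂ] Y}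
    (h : IsRightGenDrazinRieszInvertible A) :
    IsLeftGenDrazinRieszInvertible (dualOperator A) := by
  obtain ⟨B, h₁, h₂, h₃⟩ := h
  refine ⟨_root_.dualOperator B, ?_, ?_, ?_⟩
  · rw [pow_two] at h₁ ⊢
    exact ContinuousLinearMap.ext fun f => ContinuousLinearMap.ext fun x =>
      congrArg f (DFunLike.congr_fun h₁ x)
  · rw [pow_two] at h₂ ⊢
    exact ContinuousLinearMap.ext fun f => ContinuousLinearMap.ext fun x =>
      congrArg f (DFunLike.congr_fun h₂ x)
  · have h := h₃.dualOperator
    rwa [dualOperator_sub] at h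

end DrazinRiesz

theorem mainTheorem9 {X : Type*} [NormedAddCommGroup X] [NormedSpace ℂ X] [CompleteSpace X]
    (A : X →L[ℂ] X) :
    (∀ (M N : Submodule ℂ X) (h : CompletelyReduces A M N),
      (A.restrict h.invariant_left).HasLeftInverse →
      IsRieszOperator (A.restrict h.invariant_right) →
      ∃ h' : CompletelyReduces (dualOperator A) (annihilatorDual N) (annihilatorDual M),
        ((dualOperator A).restrict h'.invariant_left).HasRightInverse ∧
        IsRieszOperator (X := annihilatorDual M) ((dualOperator A).restrict h'.invariant_right)) ∧
    (∀ (M N : Submodule ℂ X) (h : CompletelyReduces A M N),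
      (A.restrict h.invariant_left).HasRightInverse →
      IsRieszOperator (A.restrict h.invariant_right) →
      ∃ h' : CompletelyReduces (dualOperator A) (annihilatorDual N) (annihilatorDual M),
        ((dualOperator A).restrict h'.invariant_left).HasLeftInverse ∧
        IsRieszOperator (X := annihilatorDual M) ((dualOperator A).restrict h'.invariant_right)) ∧
    (IsLeftGenDrazinRieszInvertible A → IsRightGenDrazinRieszInvertible (dualOperator A)) ∧
    (IsRightGenDrazinRieszInvertible A → IsLeftGenDrazinRieszInvertible (dualOperator A)) := by
  exact ⟨fun M N h hM hN => ⟨h.dual, h.hasRightInverse_dual hM, h.isRieszOperator_dual hN⟩,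
    fun M N h hM hN => ⟨h.dual, h.hasLeftInverse_dual hM, h.isRieszOperator_dual hN⟩,
    fun h => h.dualOperator, fun h => h.dualOperator⟩
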